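/- An abstract numeration system with zeros is a tuple $\mathcal N=(L,A,<,0)$, where $A$ is a finite alphabet totally ordered by $<$ with least element $0\in A$, and $L\subseteq A^*$ is a language such that $\varepsilon\in L$, $w\in L\Leftrightarrow 0w\in L$ for all $w\in A^*$, and $L\setminus 0^+L$ is infinite. For $n\in\mathbb N=\{0,1,2,\dots\}$, $\operatorname{rep}_{\mathcal N}(n)$ is the $n$-th element (counted from $0$) of $L\setminus 0^+L$ in radix order (first by length, then lexicographically). For $u\in L$, $\operatorname{val}_{\mathcal N}(u)$ is the unique $n$ with $u\in 0^*\operatorname{rep}_{\mathcal N}(n)$; it is undefined for $u\notin L$. For words $u_1,\dots,u_m\in A^*$ of equal length, $\langle u_1,\dots,u_m\rangle$ is the word over $A^m$ obtained by reading them in parallel. A relation $R\subseteq\mathbb N^m$ is $\mathcal N$-synchronized if $\{\langle u_1,\dots,u_m\rangle : u_1,\dots,u_m\in L,\ |u_1|=\dots=|u_m|,\ (\operatorname{val}_{\mathcal N}(u_1),\dots,\operatorname{val}_{\mathcal N}(u_m))\in R\}$ is a regular language. The system $\mathcal N$ is regular if $L$ is a regular language and the relation $\{(a,b,c): a+b=c\}$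 is $\mathcal N$-synchronized. A sequence $\mathbf x\in B^{\mathbb N}$ is $\mathcal N$-automatic if there is a deterministic finite automaton with output whose output on $u\in A^*$ is defined exactly when $\operatorname{val}_{\mathcal N}(u)$ is defined, and is then equal to $\mathbf x[\operatorname{val}_{\mathcal N}(u)]$. For $n_1,\dots,n_m\in\mathbb N$ let $\operatorname{rep}_{\mathcal N}(n_1,\dots,n_m)=\langle u_1,\dots,u_m\rangle$, where $u_i$ is $\operatorname{rep}_{\mathcal N}(n_i)$ padded on the left with zeros to the length $\max_j|\operatorname{rep}_{\mathcal N}(n_j)|$. A function $f:\mathbb N^m\to\mathbb C$ is $\mathcal N$-regular if there are $d\in\mathbb N$, a row vector $\lambda\in\mathbb C^{d}$, a column vector $\gamma\in\mathbb C^{d}$ and a monoid morphism $\mu:(A^m)^*\to\mathbb C^{d\times d}$ such that $f(n_1,\dots,n_m)=\lambda\,\mu(\operatorname{rep}_{\mathcal N}(n_1,\dots,n_m))\,\gamma$ for all $n_1,\dots,n_m\in\mathbb N$. For words $u,w$, let $|u|_w$ be the number of occurrences of $w$ as a factor of $u$ (with $|u|_\varepsilon=|u|+1$). Let $\mathbf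 x[i..i+n)=\mathbf x[i]\cdots\mathbf x[i+n-1]$, let $F_n(\mathbf x)$ be the set of these length-$n$ factors of $\mathbf x$, and let $F(\mathbf x)=\bigcup_n F_n(\mathbf x)$. The sequence $\mathbf x$ is uniformly factor-balanced if there is a constant $C$ such that $\bigl||u|_w-|v|_w\bigr|\le C$ for all $n\in\mathbb N$, all $u,v\in F_n(\mathbf x)$ and all $w\in F(\mathbf x)$. For $k\in\mathbb N$, write $u\sim_k v$ if $|u|_w=|v|_w$ for every word $w$ of length at most $k$ (so $u\sim_0 v$ just means $|u|=|v|$). Let $$\operatorname{abeq}_{\mathbf x}=\{(i,j,k,n)\in\mathbb N^4:\ \mathbf x[i..i+n)\sim_k\mathbf x[j..j+n)\},$$ and let $\rho^{k}_{\mathbf x}(n)$ be the number of $\sim_k$-equivalence classes of words in $F_n(\mathbf x)$ (the $k$-abelian complexity). Theorem. Let $\mathcal N$ be a regular abstract numeration system with zeros, and let $\mathbf x$ be a sequence that is uniformly factor-balanced and $\mathcal N$-automatic. Then the relation $\operatorname{abeq}_{\mathbf x}$ is $\mathcal N$-synchronized, and the two-dimensional function $(k,n)\mapsto\rho^{k}_{\mathbf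 x}(n)$ is $\mathcal N$-regular. -/

import Mathlib

/-! ### Words and generalized abelian complexity -/

/-- The number `|u|_w` of occurrences of the word `w` as a factor of the word `u`
(so `|u|_ε = |u| + 1`). -/
noncomputable def occCount {B : Type*} (w u : List B) : ℕ :=
  {p : ℕ | p ≤ u.length ∧ w <+: u.drop p}.ncard

/-- The factor `x[i] x[i+1] ⋯ x[i+n-1]` of length `n` of the sequence `x`. -/
def factorAt {B : Type*} (x : ℕ → B) (i n : ℕ) : List B :=
  (List.range' i n).map x

/-- The set of factors of length `n` of the sequence `x`. -/
def factorsOfLength {B : Type*} (x : ℕ → B) (n : ℕ) : Set (List B) :=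
  {u | ∃ i, u = factorAt x i n}

/-- The set of all factors of the sequence `x`. -/
def factors {B : Type*} (x : ℕ → B) : Set (List B) :=
  {u | ∃ n, u ∈ factorsOfLength x n}

/-- There is a single bound `C` with `| |u|_w - |v|_w | ≤ C` for all factors `u, v, w` of `x`
with `|u| = |v|`. -/
def UniformlyFactorBalanced {B : Type*} (x : ℕ → B) : Prop :=
  ∃ C : ℕ, ∀ n : ℕ, ∀ u ∈ factorsOfLength x n, ∀ v ∈ factorsOfLength x n, ∀ w ∈ factors x,
    |(occCount w u : ℤ) - (occCount w v : ℤ)| ≤ C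

/-- `u ∼_k v`: every word of length at most `k` occurs equally often in `u` and in `v`. -/
def kAbelianEquiv {B : Type*} (k : ℕ) (u v : List B) : Prop :=
  ∀ w : List B, w.length ≤ k → occCount w u = occCount w v

/-- `k`-abelian equivalence as a setoid. -/
def kAbelianSetoid (B : Type*) (k : ℕ) : Setoid (List B) where
  r := kAbelianEquiv k
  iseqv :=
    { refl := fun _ _ _ => rfl
      symm := fun h w hw => (h w hw).symm
      trans := fun h₁ h₂ w hw => (h₁ w hw).trans (h₂ w hw) }

/-- The `k`-abelian complexity of `x` at `n`: the number of factors of `x` of length `n` up to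
`k`-abelian equivalence. -/
noncomputable def kAbelianComplexity {B : Type*} (x : ℕ → B) (k n : ℕ) : ℕ :=
  (Quotient.mk (kAbelianSetoid B k) '' factorsOfLength x n).ncard

/-- The relation `abeq_x`: the set of `(i, j, k, n)` such that the factors of length `n` of `x`
at the positions `i` and `j` are `k`-abelian equivalent. -/
def abeqRel {B : Type*} (x : ℕ → B) : Set (Fin 4 → ℕ) :=
  {v | kAbelianEquiv (v 2) (factorAt x (v 0) (v 3)) (factorAt x (v 1) (v 3))}

/-! ### Abstract numeration systems -/

/-- An abstract numeration system with zeros `(L, A, <, 0)` over the finite ordered alphabet `A`.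
The words of `L` that are not in `0⁺ L` are the canonical ones; there are infinitely many. -/
structure ANSZ (A : Type*) [LinearOrder A] [Finite A] where
  lang : Language A
  zero : A
  zero_le : ∀ a : A, zero ≤ a
  nil_mem : [] ∈ lang
  zero_cons_mem_iff : ∀ w : List A, zero :: w ∈ lang ↔ w ∈ lang
  infinite_canonical :
    {w : List A | w ∈ lang ∧
      ¬ ∃ m : ℕ, 0 < m ∧ ∃ v ∈ lang, w = List.replicate m zero ++ v}.Infinite

namespace ANSZ

/-- The canonical words: `L \ 0⁺ L`. -/
def canonical {A : Type*} [LinearOrder A] [Finite A] (N : ANSZ A) : Set (List A) :=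
  {w | w ∈ N.lang ∧ ¬ ∃ m : ℕ, 0 < m ∧ ∃ v ∈ N.lang, w = List.replicate m N.zero ++ v}

/-- The set of canonical words that precede `w` in radix order. -/
def below {A : Type*} [LinearOrder A] [Finite A] (N : ANSZ A) (w : List A) : Set (List A) :=
  {v | v ∈ N.canonical ∧ List.Shortlex (· < ·) v w}

theorem exists_canonical_ncard_below {A : Type*} [LinearOrder A] [Finite A] (N : ANSZ A)
    (n : ℕ) : ∃ w ∈ N.canonical, (N.below w).ncard = n := by
  have hwf : WellFounded (List.Shortlex ((· < ·) : A → A → Prop)) :=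
    List.Shortlex.wf wellFounded_lt
  have hfin : ∀ w : List A, {v : List A | v.length ≤ w.length}.Finite :=
    fun w => List.finite_length_le A w.length
  have hlen : ∀ v w : List A, List.Shortlex (· < ·) v w → v.length ≤ w.length := by
    intro v w h
    rcases List.shortlex_def.1 h with h | h
    · exact h.le
    · exact h.1.le
  have hbfin : ∀ w : List A, (N.below w).Finite :=
    fun w => (hfin w).subset fun v hv => hlen v w hv.2
  have htrans : ∀ {u v w : List A}, List.Shortlex (· < ·) u v → List.Shortlex (· < ·) v w →
      List.Shortlex (· < ·) u w := by
    intro u v w h₁ h₂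
    rw [List.shortlex_def] at h₁ h₂ ⊢
    rcases h₁ with h₁ | ⟨h₁, h₁'⟩ <;> rcases h₂ with h₂ | ⟨h₂, h₂'⟩
    · exact Or.inl (h₁.trans h₂)
    · exact Or.inl (h₂ ▸ h₁)
    · exact Or.inl (h₁ ▸ h₂)
    · exact Or.inr ⟨h₁.trans h₂, List.lt_trans (α := A) h₁' h₂'⟩
  induction n with
  | zero =>
    obtain ⟨w, hw, hmin⟩ := hwf.has_min N.canonical N.infinite_canonical.nonempty
    refine ⟨w, hw, ?_⟩
    rw [Set.ncard_eq_zero (hbfin w)]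
    ext v
    simp only [Set.mem_empty_iff_false, iff_false]
    exact fun hv => hmin v hv.1 hv.2
  | succ n ih =>
    obtain ⟨w, hw, hn⟩ := ih
    have hne : {v | v ∈ N.canonical ∧ List.Shortlex (· < ·) w v}.Nonempty := by
      obtain ⟨v, hv, hvw⟩ := (Set.Infinite.sdiff N.infinite_canonical (hfin w)).nonempty
      refine ⟨v, hv, List.shortlex_def.2 (Or.inl ?_)⟩
      simpa using hvw
    obtain ⟨z, ⟨hz, hwz⟩, hmin⟩ := hwf.has_min _ hne
    refine ⟨z, hz, ?_⟩
    have hins : N.below z = insert w (N.below w) := by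
      ext v
      simp only [Set.mem_insert_iff]
      constructor
      · rintro ⟨hv, hvz⟩
        rcases trichotomous_of (List.Shortlex ((· < ·) : A → A → Prop)) v w with h | h | h
        · exact Or.inr ⟨hv, h⟩
        · exact Or.inl h
        · exact absurd hvz (hmin v ⟨hv, h⟩)
      · rintro (rfl | ⟨hv, hvw⟩)
        · exact ⟨hw, hwz⟩
        · exact ⟨hv, htrans hvw hwz⟩
    have hnot : w ∉ N.below w := fun h => hwf.irrefl.irrefl w h.2
    rw [hins, Set.ncard_insert_of_notMem hnot (hbfin w), hn]

/-- The representation of `n`: the `n`-th canonical word in radix order, counted from `0`. -/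
noncomputable def rep {A : Type*} [LinearOrder A] [Finite A] (N : ANSZ A) (n : ℕ) : List A :=
  (N.exists_canonical_ncard_below n).choose

/-- `N.HasVal u n`: the valuation of the word `u` is defined and equal to `n`, that is,
`u ∈ 0^* rep n`. -/
def HasVal {A : Type*} [LinearOrder A] [Finite A] (N : ANSZ A) (u : List A) (n : ℕ) : Prop :=
  ∃ m : ℕ, u = List.replicate m N.zero ++ N.rep n

/-- An `m`-ary relation on `ℕ` is synchronized when the words over `A^m` whose component words
are representations, of a common length, of a tuple in the relation form a regular language. -/
def IsSynchronized {A : Type*} [LinearOrder A] [Finite A] (N : ANSZ A) {m : ℕ}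
    (R : Set (Fin m → ℕ)) : Prop :=
  Language.IsRegular (T := Fin m → A)
    {w : List (Fin m → A) | ∃ n ∈ R, ∀ i : Fin m, N.HasVal (w.map fun a => a i) (n i)}

/-- A numeration system is regular when its language and its addition relation are regular. -/
def IsRegular {A : Type*} [LinearOrder A] [Finite A] (N : ANSZ A) : Prop :=
  N.lang.IsRegular ∧ N.IsSynchronized {v : Fin 3 → ℕ | v 0 + v 1 = v 2}

/-- `x` is computed by a deterministic finite automaton with (partial) output: the output on the
word `u` is defined exactly if the valuation of `u` is, and it is then `x[val u]`. -/
def IsAutomatic {A : Type*} [LinearOrder A] [Finite A] (N : ANSZ A) {B : Type*}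
    (x : ℕ → B) : Prop :=
  ∃ (σ : Type) (_ : Finite σ) (step : σ → A → σ) (start : σ) (out : σ → Option B),
    ∀ (u : List A) (b : B),
      out (u.foldl step start) = some b ↔ ∃ n, N.HasVal u n ∧ x n = b

/-- The representation of a tuple: the representations of its entries are padded with leading
zeros to the largest of their lengths and read in parallel. -/
noncomputable def repTuple {A : Type*} [LinearOrder A] [Finite A] (N : ANSZ A) {m : ℕ}
    (n : Fin m → ℕ) : List (Fin m → A) :=
  let len := Finset.univ.sup fun i : Fin m => (N.rep (n i)).length
  List.ofFn fun (p : Fin len) (i : Fin m) =>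
    ((N.rep (n i)).leftpad len N.zero).getD p N.zero

/-- A function `f` of `m` natural numbers is regular when it has a linear representation
`f n = lam * mu (rep n) * gam` over `ℂ`, with `mu` a matrix-valued morphism on words. -/
def IsRegularFun {A : Type*} [LinearOrder A] [Finite A] (N : ANSZ A) {m : ℕ}
    (f : (Fin m → ℕ) → ℂ) : Prop :=
  ∃ (d : ℕ) (lam : Fin d → ℂ) (mu : FreeMonoid (Fin m → A) →* Matrix (Fin d) (Fin d) ℂ)
    (gam : Fin d → ℂ),
    ∀ n : Fin m → ℕ,
      f n = dotProduct lam (Matrix.mulVec (mu (FreeMonoid.ofList (N.repTuple n))) gam)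

end ANSZ

/-!
Call a predicate on tuples of natural numbers definable if the corresponding relation is
synchronized. In a regular numeration system the definable predicates are closed under the
first-order connectives and contain addition. For quantifiers, the language of a projected relation
has to be freed of the leading zeros that were needed for long witnesses
(`Language.IsRegular.map_strip`); this and other closure properties follow from the Myhill-Nerode
theorem. In particular, equality of two factors of an automatic sequence `x`, given by their
positions and their length, is definable.

The number of solutions `p` of a definable predicate `P (p, n)` with finitely many solutions for
every `n` has a linear representation: the matrices count the transitions of an automaton for `P`
over all letters of the component `p`. Solutions `p` that are longer than the representation of
`n` are reached by additional leading zeros. The number of zeros needed is bounded uniformly in `n`,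
because the spans of the tails of a sequence in a finite-dimensional space become constant
(`ANSZ.Definable.exists_linear_representation`).

The number of occurrences of `x[p..p+l)` in `x[i..i+n)` is such a counting function. Uniform balance
says that its values for `i` and `j` have a bounded difference. A function with a linear
representation that takes finitely many values has regular level sets, since each quotient of a
level set is determined by finitely many values of the function
(`Language.isRegular_setOf_eq_zero`). Hence equality of the two numbers is definable, and
quantifying over all `p` and all `l ≤ k` defines `k`-abelian equivalence. The `k`-abelian complexity
at `n` is the number of positions `i` such that the factor at `i` is not equivalent to one at a
smaller position; this is again a counting function of a definable predicate with finitely many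
solutions.
-/

/-! ### Valuations -/

namespace ANSZ

theorem shortlex_trans {A : Type*} [LinearOrder A] {u v w : List A}
    (h₁ : List.Shortlex (· < ·) u v) (h₂ : List.Shortlex (· < ·) v w) :
    List.Shortlex (· < ·) u w := by
  rw [List.shortlex_def] at h₁ h₂ ⊢
  rcases h₁ with h₁ | ⟨h₁, h₁'⟩ <;> rcases h₂ with h₂ | ⟨h₂, h₂'⟩
  · exact Or.inl (h₁.trans h₂)
  · exact Or.inl (h₂ ▸ h₁)
  · exact Or.inl (h₁ ▸ h₂)
  · exact Or.inr ⟨h₁.trans h₂, List.lt_trans (α := A) h₁' h₂'⟩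

variable {A : Type*} [LinearOrder A] [Finite A] (N : ANSZ A)

theorem rep_mem_canonical (n : ℕ) : N.rep n ∈ N.canonical :=
  (N.exists_canonical_ncard_below n).choose_spec.1

theorem ncard_below_rep (n : ℕ) : (N.below (N.rep n)).ncard = n :=
  (N.exists_canonical_ncard_below n).choose_spec.2

/-- Canonical words do not begin with the letter zero, because `0 w ∈ L` implies `w ∈ L`. -/
theorem zero_cons_notMem_canonical (w : List A) : N.zero :: w ∉ N.canonical := fun h =>
  h.2 ⟨1, one_pos, w, (N.zero_cons_mem_iff w).1 h.1, rfl⟩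

theorem replicate_append_mem_iff (m : ℕ) (w : List A) :
    List.replicate m N.zero ++ w ∈ N.lang ↔ w ∈ N.lang := by
  induction m with
  | zero => simp
  | succ m ih => rw [List.replicate_succ, List.cons_append, N.zero_cons_mem_iff, ih]

theorem below_finite (w : List A) : (N.below w).Finite := by
  refine (List.finite_length_le A w.length).subset fun v hv => ?_
  rcases List.shortlex_def.1 hv.2 with h | h
  · exact h.le
  · exact h.1.le

theorem ncard_below_lt {v w : List A} (hv : v ∈ N.canonical) (h : List.Shortlex (· < ·) v w) :
    (N.below v).ncard < (N.below w).ncard := by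
  refine Set.ncard_lt_ncard ⟨fun u hu => ⟨hu.1, shortlex_trans hu.2 h⟩, fun hsub => ?_⟩
    (N.below_finite w)
  have hwf : WellFounded (List.Shortlex ((· < ·) : A → A → Prop)) :=
    List.Shortlex.wf wellFounded_lt
  exact hwf.irrefl.irrefl v (hsub ⟨hv, h⟩).2

/-- Every canonical word is the representation of the number of its predecessors. -/
theorem rep_ncard_below {w : List A} (hw : w ∈ N.canonical) : N.rep (N.below w).ncard = w := by
  have hc := N.rep_mem_canonical (N.below w).ncard
  have hn := N.ncard_below_rep (N.below w).ncard
  rcases trichotomous_of (List.Shortlex ((· < ·) : A → A → Prop))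
    (N.rep (N.below w).ncard) w with h | h | h
  · exact absurd hn (N.ncard_below_lt hc h).ne
  · exact h
  · exact absurd hn (N.ncard_below_lt hw h).ne'

theorem replicate_append_inj {u v : List A} (hu : u ∈ N.canonical) (hv : v ∈ N.canonical)
    {m m' : ℕ} (h : List.replicate m N.zero ++ u = List.replicate m' N.zero ++ v) : u = v := by
  induction m generalizing m' with
  | zero =>
    cases m' with
    | zero => simpa using h
    | succ m' =>
      simp only [List.replicate_zero, List.nil_append, List.replicate_succ, List.cons_append] at h
      exact absurd (h ▸ hu) (N.zero_cons_notMem_canonical _)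
  | succ m ih =>
    cases m' with
    | zero =>
      simp only [List.replicate_zero, List.nil_append, List.replicate_succ, List.cons_append] at h
      exact absurd (h ▸ hv) (N.zero_cons_notMem_canonical _)
    | succ m' =>
      simp only [List.replicate_succ, List.cons_append, List.cons.injEq, true_and] at h
      exact ih h

variable {N}

theorem HasVal.unique {u : List A} {n n' : ℕ} (h : N.HasVal u n) (h' : N.HasVal u n') :
    n = n' := by
  obtain ⟨m, rfl⟩ := h
  obtain ⟨m', h'⟩ := h'
  have := N.replicate_append_inj (N.rep_mem_canonical n) (N.rep_mem_canonical n') h'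
  rw [← N.ncard_below_rep n, this, N.ncard_below_rep]

theorem HasVal.mem_lang {u : List A} {n : ℕ} (h : N.HasVal u n) : u ∈ N.lang := by
  obtain ⟨m, rfl⟩ := h
  exact (N.replicate_append_mem_iff m _).2 (N.rep_mem_canonical n).1

theorem HasVal.replicate_append {u : List A} {n : ℕ} (h : N.HasVal u n) (t : ℕ) :
    N.HasVal (List.replicate t N.zero ++ u) n := by
  obtain ⟨m, rfl⟩ := h
  exact ⟨t + m, by rw [← List.append_assoc, List.replicate_append_replicate]⟩

variable (N)

theorem exists_hasVal {u : List A} (hu : u ∈ N.lang) : ∃ n, N.HasVal u n := by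
  induction u with
  | nil =>
    have : ([] : List A) ∈ N.canonical := by
      refine ⟨hu, ?_⟩
      rintro ⟨m, hm, v, -, h⟩
      simp only [List.nil_eq, List.append_eq_nil_iff, List.replicate_eq_nil_iff] at h
      omega
    exact ⟨_, 0, by rw [N.rep_ncard_below this]; rfl⟩
  | cons a u ih =>
    by_cases ha : a = N.zero
    · subst ha
      obtain ⟨n, hn⟩ := ih ((N.zero_cons_mem_iff u).1 hu)
      exact ⟨n, hn.replicate_append 1⟩
    · have : a :: u ∈ N.canonical := by
        refine ⟨hu, ?_⟩
        rintro ⟨m, hm, v, -, h⟩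
        obtain ⟨m, rfl⟩ := Nat.exists_eq_succ_of_ne_zero hm.ne'
        rw [List.replicate_succ, List.cons_append] at h
        exact ha (List.cons.inj h).1
      exact ⟨_, 0, by rw [N.rep_ncard_below this]; rfl⟩

theorem hasVal_replicate_append_iff (t : ℕ) (u : List A) (n : ℕ) :
    N.HasVal (List.replicate t N.zero ++ u) n ↔ N.HasVal u n := by
  refine ⟨fun h => ?_, fun h => h.replicate_append t⟩
  obtain ⟨n', hn'⟩ := N.exists_hasVal ((N.replicate_append_mem_iff t u).1 h.mem_lang)
  rwa [h.unique (hn'.replicate_append t)]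

theorem hasVal_replicate_rep (m n : ℕ) : N.HasVal (List.replicate m N.zero ++ N.rep n) n :=
  ⟨m, rfl⟩

/-- The word `w` over `A ^ m` represents the tuple `n`, possibly with leading zeros. -/
def HasVals {m : ℕ} (w : List (Fin m → A)) (n : Fin m → ℕ) : Prop :=
  ∀ i, N.HasVal (w.map fun a => a i) (n i)

variable {N} in
theorem HasVals.unique {m : ℕ} {w : List (Fin m → A)} {n n' : Fin m → ℕ} (h : N.HasVals w n)
    (h' : N.HasVals w n') : n = n' :=
  funext fun i => (h i).unique (h' i)

/-- The letter `(0, …, 0)` of `A ^ m`. -/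
def zeros (m : ℕ) : Fin m → A := fun _ => N.zero

theorem hasVals_replicate_append_iff {m : ℕ} (t : ℕ) (w : List (Fin m → A)) (n : Fin m → ℕ) :
    N.HasVals (List.replicate t (N.zeros m) ++ w) n ↔ N.HasVals w n := by
  refine forall_congr' fun i => ?_
  rw [List.map_append, List.map_replicate]
  exact N.hasVal_replicate_append_iff _ _ _

theorem hasVals_repTuple {m : ℕ} (n : Fin m → ℕ) : N.HasVals (N.repTuple n) n := by
  intro i
  set len := Finset.univ.sup fun i : Fin m => (N.rep (n i)).length with hlen
  have hle : (N.rep (n i)).length ≤ len :=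
    Finset.le_sup (f := fun i : Fin m => (N.rep (n i)).length) (Finset.mem_univ i)
  refine ⟨len - (N.rep (n i)).length, ?_⟩
  change _ = List.leftpad len N.zero (N.rep (n i))
  have hl : (List.leftpad len N.zero (N.rep (n i))).length = len := by
    simp only [List.leftpad, List.length_append, List.length_replicate]; omega
  apply List.ext_getElem
  · rw [hl]; simp [repTuple, ← hlen]
  · intro p h₁ h₂'
    simp only [repTuple, List.getElem_map, List.getElem_ofFn]
    exact List.getD_eq_getElem _ _ h₂'

/-! ### Synchronized relations -/

/-- The words that represent some tuple in `R`; by definition, `R` is synchronized if this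
language is regular. -/
def relLang {m : ℕ} (R : Set (Fin m → ℕ)) : Language (Fin m → A) :=
  {w | ∃ n ∈ R, N.HasVals w n}

variable {N} in
theorem HasVals.mem_relLang_iff {m : ℕ} {R : Set (Fin m → ℕ)} {w : List (Fin m → A)}
    {n : Fin m → ℕ} (h : N.HasVals w n) : w ∈ N.relLang R ↔ n ∈ R :=
  ⟨fun ⟨_, hR, h'⟩ => h.unique h' ▸ hR, fun hR => ⟨n, hR, h⟩⟩

/-- A predicate on tuples of natural numbers is definable if the corresponding relation is
synchronized. Definable predicates are closed under the first-order connectives. -/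
def Definable {m : ℕ} (P : (Fin m → ℕ) → Prop) : Prop := N.IsSynchronized {v | P v}

theorem definable_iff {m : ℕ} {P : (Fin m → ℕ) → Prop} :
    N.Definable P ↔ (N.relLang {v | P v}).IsRegular := Iff.rfl

end ANSZ

/-! ### Regular languages -/

theorem Language.IsRegular.preimage_map {α β : Type*} {L : Language β} (h : L.IsRegular)
    (f : α → β) : Language.IsRegular (T := α) (List.map f ⁻¹' L) := by
  obtain ⟨σ, _, M, rfl⟩ := h
  exact ⟨σ, inferInstance, M.comap f, M.accepts_comap f⟩

theorem Language.IsRegular.iInf {α ι : Type*} [Finite ι] {L : ι → Language α}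
    (h : ∀ i, (L i).IsRegular) : Language.IsRegular {w | ∀ i, w ∈ L i} := by
  refine Language.IsRegular.of_finite_range_leftQuotient ?_
  refine (Set.Finite.pi' fun i => (h i).finite_range_leftQuotient).image
    (fun q : ι → Language α => ({w | ∀ i, w ∈ q i} : Language α)) |>.subset ?_
  rintro _ ⟨u, rfl⟩
  exact ⟨fun i => (L i).leftQuotient u, fun i => ⟨u, rfl⟩, rfl⟩

/-- The words over `β` that become, after some power of the letter `z` has been put in front of
them, the image of a word of a regular language under a letter-to-letter map form a regular
language. -/
theorem Language.IsRegular.map_strip {α β : Type*} {L : Language α} (h : L.IsRegular) (f : α → β)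
    (z : β) : Language.IsRegular
      {v : List β | ∃ t : ℕ, ∃ w ∈ L, w.map f = List.replicate t z ++ v} := by
  refine Language.IsRegular.of_finite_range_leftQuotient ?_
  -- The quotient by `u` depends only on the set of quotients of `L` by the words above `z ^ t u`.
  refine (h.finite_range_leftQuotient.powerset.image
    (fun S : Set (Language α) => ({v | ∃ q ∈ S, ∃ w ∈ q, w.map f = v} : Language β))).subset ?_
  rintro _ ⟨u, rfl⟩
  refine ⟨{q | ∃ t : ℕ, ∃ w : List α, w.map f = List.replicate t z ++ u ∧ q = L.leftQuotient w},
    ?_, ?_⟩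
  · rintro _ ⟨t, w, -, rfl⟩
    exact ⟨w, rfl⟩
  · ext v
    constructor
    · rintro ⟨_, ⟨t, w, hw, rfl⟩, w', hw', rfl⟩
      exact ⟨t, w ++ w', hw', by rw [List.map_append, hw, List.append_assoc]⟩
    · rintro ⟨t, w, hw, hwv⟩
      rw [← List.append_assoc] at hwv
      obtain ⟨w₁, w₂, rfl, h₁, h₂⟩ := List.map_eq_append_iff.1 hwv
      exact ⟨_, ⟨t, w₁, h₁, rfl⟩, w₂, hw, h₂⟩

/-! ### Words read in parallel -/

/-- The word over `A ^ (m + 1)` with first component `u` and other components `v`, cut off at the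
end of the shorter one if the lengths differ. -/
def consWord {A : Type*} {m : ℕ} (u : List A) (v : List (Fin m → A)) : List (Fin (m + 1) → A) :=
  List.zipWith (fun a b => Fin.cons a b) u v

theorem map_head_consWord {A : Type*} {m : ℕ} {u : List A} {v : List (Fin m → A)}
    (h : u.length = v.length) : (consWord u v).map (fun a => a 0) = u := by
  induction u generalizing v with
  | nil => rfl
  | cons a u ih =>
    obtain _ | ⟨b, v⟩ := v
    · simp at h
    · simpa [consWord] using ih (by simpa using h)

theorem map_tail_consWord {A : Type*} {m : ℕ} {u : List A} {v : List (Fin m → A)}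
    (h : u.length = v.length) : (consWord u v).map Fin.tail = v := by
  induction u generalizing v with
  | nil =>
    obtain _ | ⟨b, v⟩ := v
    · rfl
    · simp at h
  | cons a u ih =>
    obtain _ | ⟨b, v⟩ := v
    · simp at h
    · simpa [consWord] using ih (by simpa using h)

namespace ANSZ

variable {A : Type*} [LinearOrder A] [Finite A] {N : ANSZ A}

/-! ### Closure of definable predicates under first-order logic -/

theorem IsRegular.relLang_univ (hN : N.IsRegular) (m : ℕ) :
    (N.relLang (Set.univ : Set (Fin m → ℕ))).IsRegular := by
  have h := Language.IsRegular.iInf fun i : Fin m =>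
    hN.1.preimage_map fun a : Fin m → A => a i
  refine (congrArg Language.IsRegular (?_ : _ = _)).mpr h
  ext w
  constructor
  · rintro ⟨n, -, hw⟩ i
    exact (hw i).mem_lang
  · intro hw
    choose n hn using fun i => N.exists_hasVal (hw i)
    exact ⟨n, trivial, hn⟩

theorem Definable.congr {m : ℕ} {P Q : (Fin m → ℕ) → Prop} (h : N.Definable P)
    (hPQ : ∀ v, P v ↔ Q v) : N.Definable Q := by
  rwa [← funext fun v => propext (hPQ v)]

theorem Definable.and {m : ℕ} {P Q : (Fin m → ℕ) → Prop} (hP : N.Definable P)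
    (hQ : N.Definable Q) : N.Definable fun v => P v ∧ Q v := by
  rw [definable_iff] at *
  convert hP.inf hQ using 1
  ext w
  constructor
  · rintro ⟨n, hn, hw⟩
    exact ⟨⟨n, hn.1, hw⟩, ⟨n, hn.2, hw⟩⟩
  · rintro ⟨⟨n, hn, hw⟩, hq⟩
    exact ⟨n, ⟨hn, hw.mem_relLang_iff.1 hq⟩, hw⟩

theorem Definable.not (hN : N.IsRegular) {m : ℕ} {P : (Fin m → ℕ) → Prop}
    (hP : N.Definable P) : N.Definable fun v => ¬ P v := by
  rw [definable_iff] at *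
  convert (hN.relLang_univ m).inf hP.compl using 1
  ext w
  constructor
  · rintro ⟨n, hn, hw⟩
    exact ⟨⟨n, trivial, hw⟩, fun h => hn (hw.mem_relLang_iff.1 h)⟩
  · rintro ⟨⟨n, -, hw⟩, hq⟩
    exact ⟨n, fun h => hq (hw.mem_relLang_iff.2 h), hw⟩

theorem Definable.imp (hN : N.IsRegular) {m : ℕ} {P Q : (Fin m → ℕ) → Prop}
    (hP : N.Definable P) (hQ : N.Definable Q) : N.Definable fun v => P v → Q v :=
  ((hP.and (hQ.not hN)).not hN).congr fun v => by tauto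

/-- Variables of a definable predicate may be renamed, identified and added. -/
theorem Definable.comp (hN : N.IsRegular) {m k : ℕ} {P : (Fin m → ℕ) → Prop}
    (hP : N.Definable P) (f : Fin m → Fin k) :
    N.Definable fun v : Fin k → ℕ => P fun i => v (f i) := by
  rw [definable_iff] at *
  convert (hN.relLang_univ k).inf (hP.preimage_map fun (a : Fin k → A) i => a (f i)) using 1
  have key : ∀ {w : List (Fin k → A)} {n : Fin k → ℕ}, N.HasVals w n →
      N.HasVals (w.map fun a i => a (f i)) fun i => n (f i) := by
    intro w n hw i
    rw [List.map_map]
    exact hw (f i)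
  ext w
  constructor
  · rintro ⟨n, hn, hw⟩
    exact ⟨⟨n, trivial, hw⟩, ⟨_, hn, key hw⟩⟩
  · rintro ⟨⟨n, -, hw⟩, hq⟩
    exact ⟨n, (key hw).mem_relLang_iff.1 hq, hw⟩

theorem hasVals_cons_iff {m : ℕ} {w : List (Fin (m + 1) → A)} {p : ℕ} {n : Fin m → ℕ} :
    N.HasVals w (Fin.cons p n : Fin (m + 1) → ℕ) ↔
      N.HasVal (w.map fun a => a 0) p ∧ N.HasVals (w.map Fin.tail) n := by
  refine Fin.forall_fin_succ.trans (and_congr Iff.rfl (forall_congr' fun i => ?_))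
  rw [List.map_map]
  rfl

theorem hasVals_consWord_iff {m : ℕ} {u : List A} {v : List (Fin m → A)}
    (h : u.length = v.length) {p : ℕ} {n : Fin m → ℕ} :
    N.HasVals (consWord u v) (Fin.cons p n : Fin (m + 1) → ℕ) ↔
      N.HasVal u p ∧ N.HasVals v n := by
  rw [hasVals_cons_iff, map_head_consWord h, map_tail_consWord h]

/-- A representation of `n` can be padded so that a representation of `p` fits above it. -/
theorem exists_hasVals_cons {m : ℕ} {v : List (Fin m → A)} {n : Fin m → ℕ} (h : N.HasVals v n)
    (p : ℕ) : ∃ t : ℕ, ∃ w : List (Fin (m + 1) → A),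
      w.map Fin.tail = List.replicate t (N.zeros m) ++ v ∧
        N.HasVals w (Fin.cons p n : Fin (m + 1) → ℕ) := by
  have hlen : (List.replicate v.length N.zero ++ N.rep p).length =
      (List.replicate (N.rep p).length (N.zeros m) ++ v).length := by
    simp [add_comm]
  refine ⟨(N.rep p).length, consWord (List.replicate v.length N.zero ++ N.rep p) _,
    map_tail_consWord hlen, (hasVals_consWord_iff hlen).2 ⟨N.hasVal_replicate_rep _ _, ?_⟩⟩
  exact (N.hasVals_replicate_append_iff _ _ _).2 h

/-- Existential quantification over the variable with index `0`. A witness may be longer than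
the other entries, which is why leading zeros have to be stripped after the projection. -/
theorem Definable.ex (hN : N.IsRegular) {m : ℕ} {P : (Fin (m + 1) → ℕ) → Prop}
    (hP : N.Definable P) :
    N.Definable fun v : Fin m → ℕ => ∃ p : ℕ, P (Fin.cons p v : Fin (m + 1) → ℕ) := by
  rw [definable_iff] at *
  convert (hN.relLang_univ m).inf (hP.map_strip Fin.tail (N.zeros m)) using 1
  ext v
  constructor
  · rintro ⟨n, ⟨p, hp⟩, hv⟩
    obtain ⟨t, w, hw, hw'⟩ := exists_hasVals_cons hv p
    exact ⟨⟨n, trivial, hv⟩, t, w, ⟨_, hp, hw'⟩, hw⟩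
  · rintro ⟨⟨n, -, hv⟩, t, w, ⟨n', hn', hw'⟩, hw⟩
    refine ⟨n, ⟨n' 0, ?_⟩, hv⟩
    rw [← Fin.cons_self_tail n', hasVals_cons_iff, hw, N.hasVals_replicate_append_iff] at hw'
    rw [hv.unique hw'.2, Fin.cons_self_tail]
    exact hn'

theorem Definable.all (hN : N.IsRegular) {m : ℕ} {P : (Fin (m + 1) → ℕ) → Prop}
    (hP : N.Definable P) :
    N.Definable fun v : Fin m → ℕ => ∀ p : ℕ, P (Fin.cons p v : Fin (m + 1) → ℕ) :=
  (((hP.not hN).ex hN).not hN).congr fun v => by simp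

theorem IsRegular.definable_add (hN : N.IsRegular) {m : ℕ} (i j k : Fin m) :
    N.Definable fun v : Fin m → ℕ => v i + v j = v k :=
  Definable.comp hN (P := fun v : Fin 3 → ℕ => v 0 + v 1 = v 2) hN.2 ![i, j, k]

theorem IsRegular.definable_le (hN : N.IsRegular) {m : ℕ} (i j : Fin m) :
    N.Definable fun v : Fin m → ℕ => v i ≤ v j :=
  ((hN.definable_add i.succ 0 j.succ).ex hN).congr fun v => by
    simp only [Fin.cons_succ, Fin.cons_zero]
    exact ⟨fun ⟨p, hp⟩ => by omega, fun h => ⟨v j - v i, by omega⟩⟩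

theorem IsRegular.definable_lt (hN : N.IsRegular) {m : ℕ} (i j : Fin m) :
    N.Definable fun v : Fin m → ℕ => v i < v j :=
  ((hN.definable_le j i).not hN).congr fun v => by simp

/-- Equality of the letters at two positions of an automatic sequence is definable. -/
theorem IsAutomatic.definable_eq {B : Type*} {x : ℕ → B} (hx : N.IsAutomatic x)
    (hN : N.IsRegular) {m : ℕ} (i j : Fin m) :
    N.Definable fun v : Fin m → ℕ => x (v i) = x (v j) := by
  suffices h : N.Definable fun v : Fin 2 → ℕ => x (v 0) = x (v 1) from h.comp hN ![i, j]
  obtain ⟨σ, _, step, start, out, hout⟩ := hx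
  have := Fintype.ofFinite σ
  -- `M i` reads the component `i`; its accepting states play no role. The pair is accepted if both
  -- outputs are defined and equal.
  let M (i : Fin 2) : DFA (Fin 2 → A) σ := ⟨fun s a => step s (a i), start, ∅⟩
  have hM : ∀ (i : Fin 2) (w : List (Fin 2 → A)) (s : σ),
      (M i).evalFrom s w = (w.map fun a => a i).foldl step s := by
    intro i w s
    rw [List.foldl_map]
    rfl
  refine ⟨σ × σ, inferInstance,
    ⟨fun s a => ((M 0).step s.1 a, (M 1).step s.2 a), (start, start),
      {s | ∃ b, out s.1 = some b ∧ out s.2 = some b}⟩, ?_⟩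
  ext w
  have hev : ∀ (w : List (Fin 2 → A)) (s : σ × σ),
      w.foldl (fun s a => ((M 0).step s.1 a, (M 1).step s.2 a)) s =
        ((M 0).evalFrom s.1 w, (M 1).evalFrom s.2 w) := by
    intro w
    induction w with
    | nil => intro s; rfl
    | cons a w ih => intro s; exact ih _
  rw [DFA.mem_accepts, DFA.eval, DFA.evalFrom, hev, hM, hM]
  simp only [Set.mem_ofPred_eq, hout]
  constructor
  · rintro ⟨b, ⟨n₀, h₀, hb₀⟩, n₁, h₁, hb₁⟩
    exact ⟨![n₀, n₁], hb₀.trans hb₁.symm, Fin.forall_fin_two.2 ⟨h₀, h₁⟩⟩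
  · rintro ⟨n, hn, hw⟩
    exact ⟨x (n 0), ⟨n 0, hw 0, rfl⟩, n 1, hw 1, Eq.symm hn⟩

end ANSZ

/-! ### Finite-dimensional state spaces -/

/-- A tail of zeros of the sequence `t ↦ ψ t c` starts at an index that does not depend on `c`:
the spans of the sets `{ψ t | t ≥ T}` decrease with `T`, hence become constant. -/
theorem exists_forall_ge_dual_eq_zero {K V : Type*} [Field K] [AddCommGroup V] [Module K V]
    [FiniteDimensional K V] (ψ : ℕ → Module.Dual K V) :
    ∃ T : ℕ, ∀ c : V, (∃ T', ∀ t ≥ T', ψ t c = 0) → ∀ t ≥ T, ψ t c = 0 := by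
  let f : ℕ →o (Submodule K (Module.Dual K V))ᵒᵈ :=
    ⟨fun T => OrderDual.toDual (Submodule.span K (ψ '' Set.Ici T)), fun T T' h =>
      OrderDual.toDual_le_toDual.2 (Submodule.span_mono (Set.image_mono (Set.Ici_subset_Ici.2 h)))⟩
  obtain ⟨T, hT⟩ := IsArtinian.monotone_stabilizes f
  refine ⟨T, fun c ⟨T', hT'⟩ t ht => ?_⟩
  have heq : Submodule.span K (ψ '' Set.Ici T) = Submodule.span K (ψ '' Set.Ici (max T T')) :=
    OrderDual.toDual.injective (hT (max T T') (le_max_left _ _))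
  have hle : Submodule.span K (ψ '' Set.Ici (max T T')) ≤
      LinearMap.ker (Module.Dual.eval K V c) := by
    rw [Submodule.span_le]
    rintro _ ⟨s, hs, rfl⟩
    exact hT' s ((le_max_right T T').trans hs)
  exact hle (heq ▸ Submodule.subset_span ⟨t, ht, rfl⟩)

/-- If `F (u ++ v)` is the value of a linear functional depending on `u` at a vector of a
finite-dimensional space depending on `v`, and `F` takes finitely many values, then the zeros of
`F` form a regular language: choosing words `v₁, …, vᵣ` whose vectors span all the vectors, the
quotient by `u` is determined by the tuple `F (u ++ v₁), …, F (u ++ vᵣ)`. -/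
theorem Language.isRegular_setOf_eq_zero {α K V : Type*} [Field K] [AddCommGroup V] [Module K V]
    [FiniteDimensional K V] (F : List α → K) (φ : List α → Module.Dual K V) (c : List α → V)
    (hF : ∀ u v, F (u ++ v) = φ u (c v)) (hfin : (Set.range F).Finite) :
    Language.IsRegular {v : List α | F v = 0} := by
  obtain ⟨S, hSc, hspan⟩ := Submodule.fg_span_iff_fg_span_finset_subset (Set.range c) |>.1
    (IsNoetherian.noetherian (R := K) (Submodule.span K (Set.range c)))
  refine Language.IsRegular.of_finite_range_leftQuotient ?_
  refine (Set.Finite.pi' fun _ : S => hfin).image (fun g : S → K => ({v | ∃ ψ : Module.Dual K V,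
    (∀ b : S, ψ b = g b) ∧ ψ (c v) = 0} : Language α)) |>.subset ?_
  rintro _ ⟨u, rfl⟩
  refine ⟨fun b => φ u b, fun b => ?_, ?_⟩
  · obtain ⟨v, hv⟩ := hSc b.2
    exact ⟨u ++ v, by rw [hF, hv]⟩
  · ext v
    constructor
    · rintro ⟨ψ, hψ, hv⟩
      have hmem : c v ∈ Submodule.span K (S : Set V) := hspan ▸ Submodule.subset_span ⟨v, rfl⟩
      have : ψ (c v) = φ u (c v) :=
        LinearMap.eqOn_span (f := ψ) (g := φ u) (fun b hb => hψ ⟨b, hb⟩) hmem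
      exact (hF u v).trans (this ▸ hv)
    · intro hv
      exact ⟨φ u, fun _ => rfl, (hF u v).symm.trans hv⟩

/-! ### Counting functions of definable relations -/

/-- The number of words `u` such that `u` and `v`, read in parallel, are accepted from `s`. -/
noncomputable def DFA.fiberCount {A σ : Type*} {m : ℕ} (M : DFA (Fin (m + 1) → A) σ)
    (v : List (Fin m → A)) (s : σ) : ℕ :=
  Nat.card {u : List A // u.length = v.length ∧ M.evalFrom s (consWord u v) ∈ M.accept}

theorem DFA.fiberCount_cons {A σ : Type*} [Fintype A] {m : ℕ} (M : DFA (Fin (m + 1) → A) σ)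
    (a : Fin m → A) (v : List (Fin m → A)) (s : σ) :
    M.fiberCount (a :: v) s = ∑ c : A, M.fiberCount v (M.step s (Fin.cons c a)) := by
  have (c : A) : Finite {u : List A // u.length = v.length ∧
      M.evalFrom (M.step s (Fin.cons c a)) (consWord u v) ∈ M.accept} :=
    ((List.finite_length_eq A v.length).subset fun u hu => hu.1).to_subtype
  simp only [fiberCount]
  rw [← Nat.card_sigma]
  refine Nat.card_congr
    { toFun := fun u => match u with
        | ⟨[], h⟩ => absurd h.1 (by simp)
        | ⟨c :: u, h⟩ => ⟨c, u, by simpa using h.1, h.2⟩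
      invFun := fun u => ⟨u.1 :: u.2.1, by simpa using u.2.2.1, u.2.2.2⟩
      left_inv := ?_
      right_inv := fun _ => rfl }
  rintro ⟨_ | ⟨c, u⟩, h⟩
  · exact absurd h.1 (by simp)
  · rfl

/-- The matrices that count the letters of the first component along transitions. -/
noncomputable def DFA.countMatrix {A : Type*} [Fintype A] {m d : ℕ}
    (M : DFA (Fin (m + 1) → A) (Fin d)) :
    FreeMonoid (Fin m → A) →* Matrix (Fin d) (Fin d) ℂ :=
  FreeMonoid.lift fun a => Matrix.of fun s s' =>
    ∑ c : A, if M.step s (Fin.cons c a) = s' then 1 else 0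

/-- Reading `w` in front of `v` acts on the vector of counts for `v` by the matrix of `w`. -/
theorem DFA.countMatrix_mulVec {A : Type*} [Fintype A] {m d : ℕ}
    (M : DFA (Fin (m + 1) → A) (Fin d)) (w v : List (Fin m → A)) :
    Matrix.mulVec (M.countMatrix (FreeMonoid.ofList w)) (fun s => (M.fiberCount v s : ℂ)) =
      fun s => (M.fiberCount (w ++ v) s : ℂ) := by
  induction w with
  | nil => simp
  | cons a w ih =>
    rw [FreeMonoid.ofList_cons, map_mul, ← Matrix.mulVec_mulVec, ih]
    funext s
    rw [List.cons_append, fiberCount_cons]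
    simp only [countMatrix, FreeMonoid.lift_eval_of, Matrix.mulVec, dotProduct, Matrix.of_apply,
      Finset.sum_mul, ite_mul, one_mul, zero_mul, Nat.cast_sum]
    rw [Finset.sum_comm]
    simp

theorem Language.IsRegular.exists_dfa_fin {α : Type*} {L : Language α} (h : L.IsRegular) :
    ∃ (d : ℕ) (M : DFA α (Fin d)), M.accepts = L := by
  obtain ⟨σ, _, M, rfl⟩ := h
  exact ⟨_, DFA.reindex (Fintype.equivFin σ) M, DFA.accepts_reindex _ _⟩

namespace ANSZ

variable {A : Type*} [LinearOrder A] [Finite A] {N : ANSZ A}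

/-- Each solution `p` that is short enough has exactly one representation of the length of `v`. -/
theorem fiberCount_of_hasVals {m : ℕ} {σ : Type*} {M : DFA (Fin (m + 1) → A) σ}
    {P : (Fin (m + 1) → ℕ) → Prop} (hM : M.accepts = N.relLang {v | P v})
    {v : List (Fin m → A)} {n : Fin m → ℕ} (hv : N.HasVals v n) :
    M.fiberCount v M.start =
      {p : ℕ | P (Fin.cons p n : Fin (m + 1) → ℕ) ∧ (N.rep p).length ≤ v.length}.ncard := by
  have hacc : ∀ u : List A, M.evalFrom M.start (consWord u v) ∈ M.accept ↔
      consWord u v ∈ N.relLang {v | P v} := fun u => by rw [← hM]; rfl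
  simp only [DFA.fiberCount, hacc]
  refine Eq.symm (Set.ncard_congr
    (t := {u : List A | u.length = v.length ∧ consWord u v ∈ N.relLang {v | P v}})
    (fun p _ => List.replicate (v.length - (N.rep p).length) N.zero ++ N.rep p) ?_ ?_ ?_)
  · rintro p ⟨hp, hle⟩
    have hlen : (List.replicate (v.length - (N.rep p).length) N.zero ++ N.rep p).length =
        v.length := by
      simp only [List.length_append, List.length_replicate]
      omega
    exact ⟨hlen, _, hp, (hasVals_consWord_iff hlen).2 ⟨N.hasVal_replicate_rep _ _, hv⟩⟩
  · intro p q _ _ h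
    exact (N.hasVal_replicate_rep _ p).unique (h ▸ N.hasVal_replicate_rep _ q)
  · rintro u ⟨hlen, n', hn', hw⟩
    rw [← Fin.cons_self_tail n', hasVals_consWord_iff hlen] at hw
    obtain ⟨⟨k, rfl⟩, hw⟩ := hw
    obtain rfl := hv.unique hw
    rw [List.length_append, List.length_replicate] at hlen
    refine ⟨n' 0, ⟨?_, by omega⟩, ?_⟩
    · rw [Fin.cons_self_tail]
      exact hn'
    · congr 2
      omega

/-- The number of solutions `p` of a definable predicate `P (p, n)` with finitely many solutions
for every `n` has a linear representation, which may be evaluated at any representation of `n`,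
with or without leading zeros. The number of solutions of length at most `|v| + t` is computed
by `t` additional leading zeros, and `t` can be chosen independently of `v`. -/
theorem Definable.exists_linear_representation {m : ℕ}
    {P : (Fin (m + 1) → ℕ) → Prop} (hP : N.Definable P)
    (hfin : ∀ n : Fin m → ℕ, {p : ℕ | P (Fin.cons p n : Fin (m + 1) → ℕ)}.Finite) :
    ∃ (d : ℕ) (lam : Fin d → ℂ) (mu : FreeMonoid (Fin m → A) →* Matrix (Fin d) (Fin d) ℂ)
      (gam : Fin d → ℂ), ∀ v : List (Fin m → A),
        (∀ n, N.HasVals v n → dotProduct lam (Matrix.mulVec (mu (FreeMonoid.ofList v)) gam) =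
          ({p : ℕ | P (Fin.cons p n : Fin (m + 1) → ℕ)}.ncard : ℂ)) ∧
        ((∀ n, ¬ N.HasVals v n) →
          dotProduct lam (Matrix.mulVec (mu (FreeMonoid.ofList v)) gam) = 0) := by
  have := Fintype.ofFinite A
  obtain ⟨d, M, hM⟩ := Language.IsRegular.exists_dfa_fin (definable_iff N |>.1 hP)
  -- `ψ t` maps the vector of counts for `v` to the number of solutions of length at most
  -- `|v| + t`. For each `v`, the differences `ψ (t + 1) - ψ t` vanish for large `t`.
  let pad (t : ℕ) : List (Fin m → A) := List.replicate t (N.zeros m)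
  let ψ (t : ℕ) : Module.Dual ℂ (Fin d → ℂ) :=
    LinearMap.proj M.start ∘ₗ Matrix.mulVecLin (M.countMatrix (FreeMonoid.ofList (pad t)))
  have hψ : ∀ t v, ψ t (fun s => (M.fiberCount v s : ℂ)) =
      (M.fiberCount (pad t ++ v) M.start : ℂ) := fun t v =>
    congrFun (M.countMatrix_mulVec (pad t) v) M.start
  obtain ⟨T, hT⟩ := exists_forall_ge_dual_eq_zero fun t => ψ (t + 1) - ψ t
  refine ⟨d, fun s => M.countMatrix (FreeMonoid.ofList (pad T)) M.start s, M.countMatrix,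
    fun s => (M.fiberCount [] s : ℂ), fun v => ?_⟩
  have hval : dotProduct (fun s => M.countMatrix (FreeMonoid.ofList (pad T)) M.start s)
      (Matrix.mulVec (M.countMatrix (FreeMonoid.ofList v)) fun s => (M.fiberCount [] s : ℂ)) =
      (M.fiberCount (pad T ++ v) M.start : ℂ) := by
    rw [M.countMatrix_mulVec, List.append_nil, ← hψ]
    rfl
  rw [hval]
  refine ⟨fun n hv => ?_, fun hv => ?_⟩
  · have hcount : ∀ t, M.fiberCount (pad t ++ v) M.start =
        {p : ℕ | P (Fin.cons p n : Fin (m + 1) → ℕ) ∧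
          (N.rep p).length ≤ t + v.length}.ncard := fun t => by
      rw [fiberCount_of_hasVals hM ((N.hasVals_replicate_append_iff t v n).2 hv)]
      simp
    obtain ⟨T', hT'⟩ := ((hfin n).image fun p => (N.rep p).length).bddAbove
    -- All solutions have length at most `T'`, but `T'` depends on `n`, in contrast to `T`.
    have hlim : ∀ t ≥ T', M.fiberCount (pad t ++ v) M.start =
        {p : ℕ | P (Fin.cons p n : Fin (m + 1) → ℕ)}.ncard := fun t ht => by
      rw [hcount]
      congr 1
      ext p
      refine and_iff_left_of_imp fun hp => ?_
      have := hT' ⟨p, hp, rfl⟩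
      simp only at this
      omega
    have hstep : ∀ t ≥ T, M.fiberCount (pad (t + 1) ++ v) M.start =
        M.fiberCount (pad t ++ v) M.start := by
      intro t ht
      have h := hT (fun s => (M.fiberCount v s : ℂ)) ⟨T', fun t ht => ?_⟩ t ht
      · rw [LinearMap.sub_apply, hψ, hψ, sub_eq_zero] at h
        exact_mod_cast h
      · rw [LinearMap.sub_apply, hψ, hψ, hlim t ht, hlim (t + 1) (by omega), sub_self]
    have hconst : ∀ k, M.fiberCount (pad (T + k) ++ v) M.start =
        M.fiberCount (pad T ++ v) M.start := by
      intro k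
      induction k with
      | zero => rfl
      | succ k ih => rw [← ih, ← hstep (T + k) (by omega), add_assoc]
    rw [← hconst T', hlim _ (by omega)]
  · have : IsEmpty {u : List A // u.length = (pad T ++ v).length ∧
        M.evalFrom M.start (consWord u (pad T ++ v)) ∈ M.accept} := by
      refine ⟨fun ⟨u, hlen, hu⟩ => ?_⟩
      have hu : consWord u (pad T ++ v) ∈ M.accepts := hu
      rw [hM] at hu
      obtain ⟨n, -, hn⟩ := hu
      rw [← Fin.cons_self_tail n, hasVals_consWord_iff hlen] at hn
      exact hv _ ((N.hasVals_replicate_append_iff _ _ _).1 hn.2)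
    rw [DFA.fiberCount, Nat.card_of_isEmpty, Nat.cast_zero]

/-- If two counting functions differ by a bounded amount, then their equality is definable: their
difference is zero on words that represent no tuple, so it takes finitely many values. -/
theorem Definable.ncard_eq (hN : N.IsRegular) {m : ℕ} {P Q : (Fin (m + 1) → ℕ) → Prop}
    (hP : N.Definable P) (hQ : N.Definable Q)
    (hPfin : ∀ n : Fin m → ℕ, {p : ℕ | P (Fin.cons p n : Fin (m + 1) → ℕ)}.Finite)
    (hQfin : ∀ n : Fin m → ℕ, {p : ℕ | Q (Fin.cons p n : Fin (m + 1) → ℕ)}.Finite)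
    (C : ℕ) (hC : ∀ n : Fin m → ℕ, |({p : ℕ | P (Fin.cons p n : Fin (m + 1) → ℕ)}.ncard : ℤ) -
      ({p : ℕ | Q (Fin.cons p n : Fin (m + 1) → ℕ)}.ncard : ℤ)| ≤ C) :
    N.Definable fun n : Fin m → ℕ => {p : ℕ | P (Fin.cons p n : Fin (m + 1) → ℕ)}.ncard =
      {p : ℕ | Q (Fin.cons p n : Fin (m + 1) → ℕ)}.ncard := by
  obtain ⟨d₁, lam₁, mu₁, gam₁, h₁⟩ := hP.exists_linear_representation hPfin
  obtain ⟨d₂, lam₂, mu₂, gam₂, h₂⟩ := hQ.exists_linear_representation hQfin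
  let F (v : List (Fin m → A)) : ℂ :=
    dotProduct lam₁ (Matrix.mulVec (mu₁ (FreeMonoid.ofList v)) gam₁) -
      dotProduct lam₂ (Matrix.mulVec (mu₂ (FreeMonoid.ofList v)) gam₂)
  have hval : ∀ v n, N.HasVals v n → F v =
      ((({p : ℕ | P (Fin.cons p n : Fin (m + 1) → ℕ)}.ncard : ℤ) -
        ({p : ℕ | Q (Fin.cons p n : Fin (m + 1) → ℕ)}.ncard : ℤ) : ℤ) : ℂ) := by
    intro v n hv
    simp only [F, (h₁ v).1 n hv, (h₂ v).1 n hv]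
    push_cast
    rfl
  have hzero : Language.IsRegular {v : List (Fin m → A) | F v = 0} := by
    refine Language.isRegular_setOf_eq_zero (V := (Fin d₁ → ℂ) × (Fin d₂ → ℂ)) F
      (fun u => LinearMap.coprod
        (dotProductEquiv ℂ (Fin d₁) lam₁ ∘ₗ Matrix.mulVecLin (mu₁ (FreeMonoid.ofList u)))
        (-(dotProductEquiv ℂ (Fin d₂) lam₂ ∘ₗ Matrix.mulVecLin (mu₂ (FreeMonoid.ofList u)))))
      (fun v => (Matrix.mulVec (mu₁ (FreeMonoid.ofList v)) gam₁,
        Matrix.mulVec (mu₂ (FreeMonoid.ofList v)) gam₂)) ?_ ?_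
    · intro u v
      simp [F, FreeMonoid.ofList_append, sub_eq_add_neg]
    · refine (((Set.finite_Icc (-(C : ℤ)) C).image fun z : ℤ => (z : ℂ)).insert 0).subset ?_
      rintro _ ⟨v, rfl⟩
      by_cases hv : ∃ n, N.HasVals v n
      · obtain ⟨n, hn⟩ := hv
        exact Or.inr ⟨_, abs_le.1 (hC n), (hval v n hn).symm⟩
      · left
        have hv : ∀ n, ¬ N.HasVals v n := fun n hn => hv ⟨n, hn⟩
        simp only [F, (h₁ v).2 hv, (h₂ v).2 hv, sub_self]
  rw [definable_iff]
  refine (congrArg Language.IsRegular (?_ : _ = _)).mpr ((hN.relLang_univ m).inf hzero)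
  ext v
  have key : ∀ n, N.HasVals v n → (F v = 0 ↔
      {p : ℕ | P (Fin.cons p n : Fin (m + 1) → ℕ)}.ncard =
        {p : ℕ | Q (Fin.cons p n : Fin (m + 1) → ℕ)}.ncard) := by
    intro n hn
    rw [hval v n hn, Int.cast_eq_zero, sub_eq_zero, Nat.cast_inj]
  constructor
  · rintro ⟨n, hn, hv⟩
    exact ⟨⟨n, trivial, hv⟩, (key n hv).2 hn⟩
  · rintro ⟨⟨n, -, hv⟩, h⟩
    exact ⟨n, (key n hv).1 h, hv⟩

end ANSZ

/-! ### Factors and their occurrences -/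

section Words

variable {B : Type*} (x : ℕ → B)

@[simp]
theorem length_factorAt (i n : ℕ) : (factorAt x i n).length = n := by
  simp [factorAt]

@[simp]
theorem getElem_factorAt (i n t : ℕ) (h : t < (factorAt x i n).length) :
    (factorAt x i n)[t] = x (i + t) := by
  simp [factorAt]

/-- Occurrences of the factor at `p` of length `l` in the factor at `i` of length `n` are counted
by a condition on single letters of the sequence. -/
theorem occCount_factorAt (p l i n : ℕ) : occCount (factorAt x p l) (factorAt x i n) =
    {r : ℕ | r + l ≤ n ∧ ∀ t < l, x (i + r + t) = x (p + t)}.ncard := by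
  unfold occCount
  congr 1
  ext r
  simp only [Set.mem_ofPred_eq, List.prefix_iff_getElem, List.length_drop, length_factorAt,
    List.getElem_drop, getElem_factorAt]
  constructor
  · rintro ⟨hr, hl, h⟩
    exact ⟨by omega, fun t ht => by rw [h t ht, add_assoc]⟩
  · rintro ⟨hl, h⟩
    exact ⟨by omega, by omega, fun t ht => by rw [← h t ht, add_assoc]⟩

theorem eq_factorAt_of_prefix_drop {w : List B} {i n r : ℕ}
    (h : w <+: (factorAt x i n).drop r) : w = factorAt x (i + r) w.length := by
  obtain ⟨hl, h⟩ := List.prefix_iff_getElem.1 h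
  refine List.ext_getElem (by simp) fun t h₁ h₂ => ?_
  rw [h t h₁, List.getElem_drop, getElem_factorAt, getElem_factorAt, add_assoc]

theorem exists_eq_factorAt_of_occCount_ne_zero {w : List B} {i n : ℕ}
    (h : occCount w (factorAt x i n) ≠ 0) : ∃ p, w = factorAt x p w.length := by
  obtain ⟨r, hr⟩ := Set.nonempty_of_ncard_ne_zero h
  exact ⟨_, eq_factorAt_of_prefix_drop x hr.2⟩

/-- Only factors of `x` have to be considered to compare factors of `x`. -/
theorem kAbelianEquiv_factorAt_iff (k i j n : ℕ) :
    kAbelianEquiv k (factorAt x i n) (factorAt x j n) ↔ ∀ p l, l ≤ k →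
      occCount (factorAt x p l) (factorAt x i n) = occCount (factorAt x p l) (factorAt x j n) := by
  refine ⟨fun h p l hl => h _ (by simpa using hl), fun h w hw => ?_⟩
  by_contra hne
  have : ∃ p, w = factorAt x p w.length := by
    by_cases h0 : occCount w (factorAt x i n) = 0
    · exact exists_eq_factorAt_of_occCount_ne_zero x (h0 ▸ Ne.symm hne)
    · exact exists_eq_factorAt_of_occCount_ne_zero x h0
  obtain ⟨p, hp⟩ := this
  exact hne (hp ▸ h p w.length hw)

theorem factorsOfLength_eq_range (n : ℕ) :
    factorsOfLength x n = Set.range fun i => factorAt x i n :=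
  Set.ext fun _ => exists_congr fun _ => eq_comm

variable {x} in
theorem factorsOfLength_finite (hx : (Set.range x).Finite) (n : ℕ) :
    (factorsOfLength x n).Finite := by
  have := hx.to_subtype
  refine ((List.finite_length_eq (Set.range x) n).image (List.map Subtype.val)).subset ?_
  rintro _ ⟨i, rfl⟩
  exact ⟨factorAt (Set.rangeFactorization x) i n, length_factorAt _ i n, List.map_map⟩

end Words

/-! ### Complexity as the number of first occurrences -/

theorem injOn_setOf_forall_lt_ne {α : Type*} (f : ℕ → α) :
    Set.InjOn f {i | ∀ j < i, f i ≠ f j} := by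
  intro i hi j hj h
  rcases lt_trichotomy i j with hlt | heq | hlt
  · exact absurd h.symm (hj i hlt)
  · exact heq
  · exact absurd h (hi j hlt)

/-- Every value of a sequence is taken at exactly one index at which it appears first. -/
theorem image_setOf_forall_lt_ne {α : Type*} (f : ℕ → α) :
    f '' {i | ∀ j < i, f i ≠ f j} = Set.range f := by
  classical
  refine (Set.image_subset_range _ _).antisymm ?_
  rintro _ ⟨i, rfl⟩
  have hex : ∃ j, f j = f i := ⟨i, rfl⟩
  refine ⟨Nat.find hex, fun j hj h => Nat.find_min hex hj ?_, Nat.find_spec hex⟩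
  rw [← h, Nat.find_spec hex]

section Complexity

variable {B : Type*} {x : ℕ → B}

theorem mk_factorAt_ne_iff (k n i j : ℕ) :
    (Quotient.mk (kAbelianSetoid B k) (factorAt x i n) ≠
      Quotient.mk (kAbelianSetoid B k) (factorAt x j n)) ↔
      ¬ kAbelianEquiv k (factorAt x i n) (factorAt x j n) :=
  not_congr Quotient.eq

theorem finite_setOf_first (hx : (Set.range x).Finite) (k n : ℕ) :
    {i | ∀ j < i, ¬ kAbelianEquiv k (factorAt x i n) (factorAt x j n)}.Finite := by
  simp only [← mk_factorAt_ne_iff]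
  refine Set.Finite.of_finite_image ?_
    (injOn_setOf_forall_lt_ne fun i => Quotient.mk (kAbelianSetoid B k) (factorAt x i n))
  rw [image_setOf_forall_lt_ne, ← Function.comp_def (Quotient.mk _) fun i => factorAt x i n,
    Set.range_comp, ← factorsOfLength_eq_range]
  exact (factorsOfLength_finite hx n).image _

/-- The `k`-abelian complexity counts the positions at which the factor of length `n` is not
`k`-abelian equivalent to an earlier one. -/
theorem kAbelianComplexity_eq_ncard (k n : ℕ) : kAbelianComplexity x k n =
    {i | ∀ j < i, ¬ kAbelianEquiv k (factorAt x i n) (factorAt x j n)}.ncard := by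
  simp only [← mk_factorAt_ne_iff]
  rw [← (injOn_setOf_forall_lt_ne fun i =>
    Quotient.mk (kAbelianSetoid B k) (factorAt x i n)).ncard_image,
    image_setOf_forall_lt_ne, ← Function.comp_def (Quotient.mk _) fun i => factorAt x i n,
    Set.range_comp, ← factorsOfLength_eq_range]
  rfl

end Complexity

namespace ANSZ

variable {A : Type*} [LinearOrder A] [Finite A] {N : ANSZ A} {B : Type*} {x : ℕ → B}

theorem IsAutomatic.finite_range (hx : N.IsAutomatic x) : (Set.range x).Finite := by
  obtain ⟨σ, _, step, start, out, hout⟩ := hx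
  refine Set.Finite.of_finite_image ((Set.finite_range out).subset ?_)
    (Option.some_injective B).injOn
  rintro _ ⟨_, ⟨n, rfl⟩, rfl⟩
  exact ⟨_, (hout (N.rep n) (x n)).2 ⟨n, N.hasVal_replicate_rep 0 n, rfl⟩⟩

/-! ### Definability of `k`-abelian equivalence -/

/-- Equality of two factors of length `v l`. -/
theorem IsAutomatic.definable_factor_eq (hx : N.IsAutomatic x) (hN : N.IsRegular) {m : ℕ}
    (q p l : Fin m) :
    N.Definable fun v : Fin m → ℕ => ∀ t < v l, x (v q + t) = x (v p + t) := by
  suffices h : N.Definable fun v : Fin 3 → ℕ => ∀ t < v 2, x (v 0 + t) = x (v 1 + t) from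
    h.comp hN ![q, p, l]
  -- The variables are `(b, a, t, q, p, l)` with `a = q + t` and `b = p + t`.
  have h₁ : N.Definable fun v : Fin 6 → ℕ => v 3 + v 2 = v 1 ∧ v 4 + v 2 = v 0 ∧
      x (v 1) = x (v 0) :=
    (hN.definable_add 3 2 1).and ((hN.definable_add 4 2 0).and (hx.definable_eq hN 1 0))
  have h₂ : N.Definable fun v : Fin 4 → ℕ => x (v 1 + v 0) = x (v 2 + v 0) :=
    ((h₁.ex hN).ex hN).congr fun v =>
      ⟨fun ⟨a, b, ha, hb, h⟩ => (congrArg x ha).trans (h.trans (congrArg x hb).symm),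
        fun h => ⟨_, _, rfl, rfl, h⟩⟩
  exact ((hN.definable_lt 0 3).imp hN h₂).all hN

/-- The variables are `(r, i, j, n, p, l)`, and `s` is `i` or `j`: the factor of length `l` at
`p` occurs with offset `r` in the factor of length `n` at `s`. -/
theorem IsAutomatic.definable_occurrence (hx : N.IsAutomatic x) (hN : N.IsRegular) (s : Fin 6) :
    N.Definable fun v : Fin 6 → ℕ => v 0 + v 5 ≤ v 3 ∧
      ∀ t < v 5, x (v s + v 0 + t) = x (v 4 + t) := by
  refine .and ?_ ?_
  · have h := (hN.definable_add (m := 7) 1 6 0).and (hN.definable_le 0 4)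
    exact (h.ex hN).congr fun v => ⟨fun ⟨_, ha, hle⟩ => ha.trans_le hle, fun h => ⟨_, rfl, h⟩⟩
  · have h := (hN.definable_add (m := 7) s.succ 1 0).and (hx.definable_factor_eq hN 0 5 6)
    refine (h.ex hN).congr fun v => ⟨fun ⟨a, ha, h⟩ => ?_, fun h => ⟨_, rfl, h⟩⟩
    obtain rfl : v s + v 0 = a := ha
    exact h

/-- By uniform balance, the numbers of occurrences of a factor in two factors of equal length
differ by a bounded amount, so that their equality is definable. -/
theorem IsAutomatic.definable_abeq (hx : N.IsAutomatic x) (hN : N.IsRegular)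
    (hbal : UniformlyFactorBalanced x) : N.Definable fun v : Fin 4 → ℕ =>
      kAbelianEquiv (v 2) (factorAt x (v 0) (v 3)) (factorAt x (v 1) (v 3)) := by
  obtain ⟨C, hC⟩ := hbal
  have hfin : ∀ (i n p l : ℕ), {r : ℕ | r + l ≤ n ∧ ∀ t < l, x (i + r + t) = x (p + t)}.Finite :=
    fun i n p l => (Set.finite_Iic n).subset fun r hr => (Nat.le_add_right r l).trans hr.1
  have hcount : N.Definable fun v : Fin 5 → ℕ =>
      occCount (factorAt x (v 3) (v 4)) (factorAt x (v 0) (v 2)) =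
        occCount (factorAt x (v 3) (v 4)) (factorAt x (v 1) (v 2)) := by
    simp only [occCount_factorAt]
    refine Definable.ncard_eq hN (hx.definable_occurrence hN 1) (hx.definable_occurrence hN 2)
      (fun v => hfin (v 0) (v 2) (v 3) (v 4)) (fun v => hfin (v 1) (v 2) (v 3) (v 4)) C
      fun v => ?_
    have h := hC (v 2) _ ⟨v 0, rfl⟩ _ ⟨v 1, rfl⟩ (factorAt x (v 3) (v 4)) ⟨v 4, v 3, rfl⟩
    rw [occCount_factorAt, occCount_factorAt] at h
    exact h
  simp only [kAbelianEquiv_factorAt_iff]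
  -- The variables are `(l, p, i, j, k, n)`; the renaming picks `(i, j, n, p, l)` from them.
  exact (((hN.definable_le (m := 6) 0 4).imp hN (hcount.comp hN ![2, 3, 5, 1, 0])).all hN).all hN

end ANSZ

theorem mainTheorem1 {A : Type*} [LinearOrder A] [Finite A] (N : ANSZ A) (hN : N.IsRegular)
    {B : Type*} (x : ℕ → B) (hx : UniformlyFactorBalanced x) (hauto : N.IsAutomatic x) :
    N.IsSynchronized (abeqRel x) ∧
      N.IsRegularFun (fun v : Fin 2 → ℕ => (kAbelianComplexity x (v 0) (v 1) : ℂ)) := by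
  have habeq := hauto.definable_abeq hN hx
  refine ⟨habeq, ?_⟩
  -- The variables are `(j, i, k, n)` before the quantifier over `j`, and `(i, k, n)` after it.
  have hfirst : N.Definable fun v : Fin 3 → ℕ => ∀ j < v 0,
      ¬ kAbelianEquiv (v 1) (factorAt x (v 0) (v 2)) (factorAt x j (v 2)) :=
    ((hN.definable_lt (m := 4) 0 1).imp hN ((habeq.comp hN ![1, 0, 2, 3]).not hN)).all hN
  obtain ⟨d, lam, mu, gam, h⟩ := hfirst.exists_linear_representation fun v =>
    finite_setOf_first hauto.finite_range (v 0) (v 1)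
  refine ⟨d, lam, mu, gam, fun v => ?_⟩
  rw [(h _).1 v (N.hasVals_repTuple v)]
  exact congrArg Nat.cast (kAbelianComplexity_eq_ncard _ _)
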